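/- Let $f(x)=\frac{1+ix}{1-ix}$ be the Cayley function, a bijection from $[-\infty,\infty)$ onto the unit circle with the convention $f(\pm\infty)=-1$. For a unitary matrix $H=\sum_\alpha f(h_\alpha)\,|\psi_\alpha\rangle\langle\psi_\alpha|$ (with $(\psi_\alpha)$ an orthonormal eigenbasis, $h_\alpha\in[-\infty,\infty)$; we write $H=f(h)$) and $\theta\in\mathbb{R}$ put $f(\theta h)=\sum_\alpha f(\theta h_\alpha)\,|\psi_\alpha\rangle\langle\psi_\alpha|$, where $0\cdot(-\infty)=0$. An architecture $\mathcal{A}$ on $n$ qubits with $m$ gates specifies, for $k=1,\dots,m$ in temporal order, the one or two distinct qubits on which the $k$-th gate acts. A circuit with architecture $\mathcal{A}$ is a tuple $C=(C_1,\dots,C_m)$ of unitary matrices $C_k\in\mathbb{U}(N_k)$, with $N_k=2$ or $N_k=4$ for gates on one or two qubits respectively; it implements the unitary $\mathcal{C}_m\cdots\mathcal{C}_1$ on $n$ qubits, where $\mathcal{C}_k=C_k\otimes\mathbb{I}$. Let $\mathcal{H}_{\mathcal{A}}$ be the distribution of the circuit $(H_1,\dots,H_m)$ whose gates $H_k$ are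 independent and Haar distributed on $\mathbb{U}(N_k)$. For a fixed circuit $C$ and $\theta\in\mathbb{R}$, let $\mathcal{H}_{\mathcal{A},C,\theta}$ be the distribution of the circuit $C(\theta)$ with gates $C_k(\theta)=C_k f(\theta h_k)$, where the $H_k=f(h_k)$ are independent and Haar distributed. Lemma. There are absolute constants $K>0$ and $\Delta_0>0$ such that for all $n,m$, every architecture $\mathcal{A}$ on $n$ qubits with $m$ gates, every circuit $C$ with architecture $\mathcal{A}$, and all real $\theta,\Delta$ with $|1-\theta|\le\Delta\le\Delta_0$, $$\|\mathcal{H}_{\mathcal{A},C,\theta}-\mathcal{H}_{\mathcal{A}}\|_{\mathrm{TVD}}\le K\,m\,\Delta ,$$ where the total variation distance is half the $L^1$ distance of the densities with respect to a common dominating measure. The same bound holds for the distributions of the $n$-qubit unitaries which the two random circuits implement. -/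

import Mathlib

/-! Random quantum circuits, the Cayley path of a circuit, and total variation distance. -/

open MeasureTheory
open scoped Kronecker

noncomputable section

/-! ### The Cayley function -/

/-- The Cayley function `f x = (1 + i x) / (1 - i x)`, extended by `f (±∞) = -1`. -/
def cayley (x : EReal) : ℂ :=
  if x = ⊥ ∨ x = ⊤ then -1
  else (1 + Complex.I * (x.toReal : ℂ)) / (1 - Complex.I * (x.toReal : ℂ))

/-- The inverse `f⁻¹ z = i (1 - z) / (1 + z)` of the Cayley function on the unit circle, with
`f⁻¹ (-1) = -∞`. The number `i (1 - z) / (1 + z)` is real when `|z| = 1`, `z ≠ -1`. -/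
def cayleyInv (z : ℂ) : EReal :=
  if z = -1 then ⊥ else ((Complex.I * (1 - z) / (1 + z)).re : EReal)

/-- The phase `f (θ x)` as a function of the phase `z = f x`. -/
def cayleyScale (θ : ℝ) (z : ℂ) : ℂ := cayley ((θ : EReal) * cayleyInv z)

theorem norm_cayley (x : EReal) : ‖cayley x‖ = 1 := by
  unfold cayley
  split_ifs
  · simp
  · set t := x.toReal
    have h : (1 - Complex.I * (t : ℂ)) = star (1 + Complex.I * (t : ℂ)) := by
      simp [sub_eq_add_neg]
    have h0 : (1 + Complex.I * (t : ℂ)) ≠ 0 := by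
      intro h0
      have := congrArg Complex.re h0
      simp at this
    rw [h, norm_div, norm_star, div_self (norm_ne_zero_iff.2 h0)]

theorem cayley_cayleyInv {z : ℂ} (hz : ‖z‖ = 1) : cayley (cayleyInv z) = z := by
  unfold cayleyInv
  split_ifs with h
  · simp [cayley, h]
  · have h1 : (1 + z) ≠ 0 := fun h1 => h (eq_neg_of_add_eq_zero_right h1)
    have hc : star z * z = 1 := by
      have := Complex.conj_mul' z
      rw [hz] at this
      simpa using this
    have h1' : (1 + star z) ≠ 0 := by
      intro h2
      apply h1
      have := congrArg star h2
      simpa using this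
    have hre : (((Complex.I * (1 - z) / (1 + z)).re : ℝ) : ℂ) = Complex.I * (1 - z) / (1 + z) := by
      rw [← Complex.conj_eq_iff_re]
      change star (Complex.I * (1 - z) / (1 + z)) = _
      have e : star (Complex.I * (1 - z) / (1 + z)) = -Complex.I * (1 - star z) / (1 + star z) := by
        simp
      rw [e, div_eq_div_iff h1' h1]
      linear_combination (2 * Complex.I) * hc
    have hI : Complex.I * (Complex.I * (1 - z) / (1 + z)) = -((1 - z) / (1 + z)) := by
      rw [mul_div_assoc, ← mul_assoc, Complex.I_mul_I, neg_one_mul]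
    unfold cayley
    rw [if_neg (by simp), EReal.toReal_coe, hre, hI]
    have e1 : 1 + -((1 - z) / (1 + z)) = (2 * z) / (1 + z) := by field_simp; ring
    have e2 : 1 - -((1 - z) / (1 + z)) = 2 / (1 + z) := by field_simp; ring
    rw [e1, e2]
    field_simp

/-! ### The unitary group and its Haar measure -/

section UnitaryGroup

variable {ι : Type*} [Fintype ι] [DecidableEq ι]

instance : MeasurableSpace (Matrix.unitaryGroup ι ℂ) := borel _

instance : BorelSpace (Matrix.unitaryGroup ι ℂ) := ⟨rfl⟩

instance : CompactSpace (Matrix.unitaryGroup ι ℂ) := by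
  have hclosed : IsClosed {U : Matrix ι ι ℂ | U ∈ Matrix.unitaryGroup ι ℂ} := by
    simp only [Matrix.mem_unitaryGroup_iff]
    exact isClosed_eq (by fun_prop) continuous_const
  have hK : IsCompact (Set.univ.pi fun _ : ι => Set.univ.pi fun _ : ι =>
      Metric.closedBall (0 : ℂ) 1) :=
    isCompact_univ_pi fun _ => isCompact_univ_pi fun _ => isCompact_closedBall _ _
  refine isCompact_iff_compactSpace.1 (IsCompact.of_isClosed_subset hK hclosed ?_)
  intro U hU i _ j _
  simpa using entry_norm_bound_of_unitary hU i j

/-- The Haar probability measure on the unitary group. -/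
def haarUnitary (ι : Type*) [Fintype ι] [DecidableEq ι] : Measure (Matrix.unitaryGroup ι ℂ) :=
  Measure.haarMeasure ⊤

instance : IsProbabilityMeasure (haarUnitary ι) :=
  ⟨by simpa [haarUnitary] using Measure.haarMeasure_self (K₀ := (⊤ : TopologicalSpace.PositiveCompacts
    (Matrix.unitaryGroup ι ℂ)))⟩

open scoped Matrix.Norms.L2Operator in
/-- `f (θ h)` for a unitary `H = f h`: if `H = ∑ₐ zₐ |ψₐ⟩⟨ψₐ|` with `zₐ = f hₐ`, then
`f (θ h) = ∑ₐ f (θ hₐ) |ψₐ⟩⟨ψₐ|`. This is the functional calculus of the normal matrix `H`. -/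
def cayleyPath (θ : ℝ) (H : Matrix.unitaryGroup ι ℂ) : Matrix.unitaryGroup ι ℂ :=
  ⟨cfc (cayleyScale θ) (H : Matrix ι ι ℂ), by
    have hn : IsStarNormal (H : Matrix ι ι ℂ) := isStarNormal_of_mem_unitary H.2
    have hfin : (spectrum ℂ (H : Matrix ι ι ℂ)).Finite := Matrix.finite_spectrum _
    refine (cfc_unitary_iff (cayleyScale θ) (H : Matrix ι ι ℂ) hn
      (hfin.continuousOn _)).2 fun z _ => ?_
    have h := Complex.conj_mul' (cayleyScale θ z)
    rw [show ‖cayleyScale θ z‖ = 1 from norm_cayley _] at h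
    simpa using h⟩

open scoped Matrix.Norms.L2Operator in
/-- At `θ = 1` the path reaches `f h = H`. -/
theorem cayleyPath_one (H : Matrix.unitaryGroup ι ℂ) : cayleyPath 1 H = H := by
  have hn : IsStarNormal (H : Matrix ι ι ℂ) := isStarNormal_of_mem_unitary H.2
  apply Subtype.ext
  change cfc (cayleyScale 1) (H : Matrix ι ι ℂ) = H
  conv_rhs => rw [← cfc_id ℂ (H : Matrix ι ι ℂ) hn]
  refine cfc_congr fun z hz => ?_
  have hz1 : ‖z‖ = 1 := by
    have := spectrum_subset_unitary_of_mem_unitary H.2 hz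
    exact CStarRing.norm_of_mem_unitary this
  simpa [cayleyScale] using cayley_cayleyInv hz1

end UnitaryGroup

/-! ### Circuits -/

/-- An architecture with `m` gates on `n` qubits: in temporal order, the one or two qubits on which
the `k`-th gate acts. -/
structure Architecture (n m : ℕ) where
  arity : Fin m → ℕ
  arity_eq : ∀ k, arity k = 1 ∨ arity k = 2
  wires : ∀ k, Fin (arity k) ↪ Fin n

/-- The unitary operators on `q` qubits, in the computational basis. -/
abbrev QubitUnitary (q : ℕ) : Type := Matrix.unitaryGroup (Fin q → Fin 2) ℂ

/-- The bit strings on `n` qubits, split into the qubits on the wires `w` and the other ones. -/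
def splitWires {q n : ℕ} (w : Fin q ↪ Fin n) :
    (Fin n → Fin 2) ≃ (Fin q → Fin 2) × ({i : Fin n // i ∉ Set.range w} → Fin 2) :=
  (Equiv.piEquivPiSubtypeProd (fun i => i ∈ Set.range w) (fun _ => Fin 2)).trans
    (Equiv.prodCongr (Equiv.arrowCongr (Equiv.ofInjective w w.injective).symm (Equiv.refl _))
      (Equiv.refl _))

/-- The operator `U ⊗ I` on `n` qubits which applies `U` to the qubits on the wires `w`. -/
def applyOnWires {q n : ℕ} (w : Fin q ↪ Fin n) (U : QubitUnitary q) : QubitUnitary n :=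
  ⟨Matrix.reindex (splitWires w).symm (splitWires w).symm
      ((U : Matrix (Fin q → Fin 2) (Fin q → Fin 2) ℂ) ⊗ₖ
        (1 : Matrix ({i : Fin n // i ∉ Set.range w} → Fin 2) _ ℂ)), by
    have h := (Matrix.mem_unitaryGroup_iff (α := ℂ)).1
      (Matrix.kronecker_mem_unitary U.2 (one_mem (unitary
        (Matrix ({i : Fin n // i ∉ Set.range w} → Fin 2) _ ℂ))))
    rw [Matrix.mem_unitaryGroup_iff]
    rw [Matrix.star_eq_conjTranspose] at h ⊢
    rw [Matrix.conjTranspose_reindex]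
    simp only [Matrix.reindex_apply]
    rw [Matrix.submatrix_mul_equiv, h, Matrix.submatrix_one_equiv]⟩

namespace Architecture

variable {n m : ℕ} (A : Architecture n m)

/-- A circuit with architecture `A`: a choice of its local gates. -/
abbrev Circuit : Type := ∀ k : Fin m, QubitUnitary (A.arity k)

/-- The unitary `𝒞ₘ ⋯ 𝒞₁`, with `𝒞ₖ = Cₖ ⊗ I`, which a circuit implements. -/
def unitaryOf (C : A.Circuit) : QubitUnitary n :=
  (List.ofFn fun k => applyOnWires (A.wires k) (C k)).reverse.prod

/-- The circuit `C(θ)` with gates `Cₖ f (θ hₖ)`, where `Hₖ = f hₖ`. -/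
def cayleyCircuit (C : A.Circuit) (θ : ℝ) (H : A.Circuit) : A.Circuit :=
  fun k => C k * cayleyPath θ (H k)

/-- The Haar random circuit distribution: independent Haar distributed local gates. -/
def haarCircuit : Measure A.Circuit := Measure.pi fun _ => haarUnitary _

/-- The `θ`-deformed Haar distribution towards `C`: the law of `C(θ)` when the `Hₖ` are independent
and Haar distributed. -/
def deformedHaar (C : A.Circuit) (θ : ℝ) : Measure A.Circuit :=
  A.haarCircuit.map (A.cayleyCircuit C θ)

end Architecture

/-! ### Total variation distance -/

/-- Total variation distance of two probability measures: half the `L¹` distance of their densities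
with respect to the dominating measure `μ + ν`. -/
def tvDist {Ω : Type*} [MeasurableSpace Ω] (μ ν : Measure Ω) : ℝ :=
  (1 / 2) * ∫ x, |(μ.rnDeriv (μ + ν) x).toReal - (ν.rnDeriv (μ + ν) x).toReal| ∂(μ + ν)

end

/-!
The Frobenius distance of two functions of normal matrices with eigenvalues `a` and `b` is
`‖g A - k B‖² = ∑ w a b * |g a - k b|²`, with nonnegative weights `w` which depend only on `A` and
`B` (`exists_frobenius_weights`). Hence a Lipschitz or expansion estimate for a scalar function
passes, with the same constant, to the function applied to matrices (`dist_frobVec_cfc_le`).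

The Haar measure of the unitary group is a multiple of the Hausdorff measure of the Frobenius
metric, in the dimension `d` of the space of Hermitian matrices. The latter measure is translation
invariant. It is finite because `h ↦ exp (i h)` is a Lipschitz map of a ball of Hermitian matrices
onto the unitary group, and nonzero because this map is bi-Lipschitz near `0`; both estimates
follow from the scalar ones for `x ↦ exp (i x)`.

The scalar map `f x ↦ f (θ x)` of the unit circle changes distances at most by the factor
`L = 1 + 2 Δ` in either direction, so the same holds for `H = f h ↦ f (θ h)`. Preimages under it
therefore have at most `L ^ d` times the Haar measure, which says that the law of `C f (θ h)` is at
most `L ^ d` times Haar measure (`map_mul_cayleyPath_le`). Gates act on one or two qubits, so `d` is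
bounded by an absolute constant `D`, and the law of `m` independent gates is at most `L ^ (D m)`
times the Haar distribution of circuits (`Architecture.deformedHaar_le`). This domination is
inherited by the laws of the implemented unitaries, and for probability measures `μ ≤ c ν` implies
a total variation distance of at most `c - 1` (`tvDist_le_of_le_smul`). With the trivial bound `1`
for large `m Δ` this gives the linear bound.
-/

/-! ### Frobenius distance and functional calculus -/

section Frobenius

variable {ι : Type*}

/-- A matrix as the vector of its entries in Euclidean space. The distance of `frobVec A` and
`frobVec B` is the Frobenius distance of `A` and `B`; working with vectors keeps the Frobenius
norm apart from the operator norm which the functional calculus uses. -/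
def frobVec (A : Matrix ι ι ℂ) : EuclideanSpace ℂ (ι × ι) :=
  WithLp.toLp 2 fun p => A p.1 p.2

theorem frobVec_sub (A B : Matrix ι ι ℂ) : frobVec (A - B) = frobVec A - frobVec B := rfl

theorem frobVec_injective : Function.Injective (frobVec : Matrix ι ι ℂ → _) := fun A B h => by
  ext i j
  exact congrArg (fun v : EuclideanSpace ℂ (ι × ι) => v (i, j)) h

variable [Fintype ι]

theorem norm_frobVec_sq (A : Matrix ι ι ℂ) : ‖frobVec A‖ ^ 2 = (star A * A).trace.re := by
  rw [EuclideanSpace.norm_sq_eq, Fintype.sum_prod_type, Finset.sum_comm, Matrix.trace]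
  simp only [Matrix.diag_apply, Matrix.mul_apply, Matrix.star_apply, Complex.re_sum]
  refine Finset.sum_congr rfl fun j _ => Finset.sum_congr rfl fun i _ => ?_
  have h := Complex.conj_mul' (A i j)
  rw [Complex.star_def, h]
  simp [frobVec, ← Complex.ofReal_pow]

variable [DecidableEq ι]

theorem continuousOn_spectrum_matrix (g : ℂ → ℂ) (A : Matrix ι ι ℂ) :
    ContinuousOn g (spectrum ℂ A) :=
  (Matrix.finite_spectrum A).continuousOn g

open scoped Matrix.Norms.L2Operator in
/-- The functional calculus of a normal matrix in terms of its spectral projections. -/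
theorem exists_spectral_projections (A : Matrix ι ι ℂ) :
    ∃ P : ℂ → Matrix ι ι ℂ, (∀ z, star (P z) = P z) ∧ (∀ z, P z * P z = P z) ∧
      (∀ z w, z ≠ w → P z * P w = 0) ∧
      ∀ g : ℂ → ℂ, cfc g A = ∑ z ∈ (Matrix.finite_spectrum A).toFinset, g z • P z := by
  classical
  have hc := fun g => continuousOn_spectrum_matrix g A
  refine ⟨fun z => cfc (fun x => if x = z then 1 else 0) A, fun z => ?_, fun z => ?_,
    fun z w hzw => ?_, fun g => ?_⟩
  · rw [← cfc_star]
    congr 1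
    ext x
    split_ifs <;> simp
  · rw [← cfc_mul _ _ A (hc _) (hc _)]
    congr 1
    ext x
    split_ifs <;> simp
  · rw [← cfc_mul _ _ A (hc _) (hc _), ← cfc_zero ℂ A]
    congr 1
    ext x
    by_cases h : x = z <;> simp [h, hzw]
  · have : ∀ z, g z • cfc (fun x => if x = z then 1 else 0) A =
        cfc (fun x => g z • if x = z then (1 : ℂ) else 0) A := fun z =>
      (cfc_smul (g z) _ A (hc _)).symm
    simp only [this]
    rw [← cfc_sum _ A _ fun _ _ => hc _]
    refine cfc_congr fun x hx => ?_
    rw [Finset.sum_apply, Finset.sum_eq_single x]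
    · simp
    · intro b _ hb
      simp [hb.symm]
    · intro h
      exact absurd ((Matrix.finite_spectrum A).mem_toFinset.2 hx) h

open scoped Matrix.Norms.L2Operator in
/-- The Frobenius distance of functions of two normal matrices is a weighted `ℓ²` distance of the
functions on pairs of eigenvalues. With spectral projections `P a` of `A` and `Q b` of `B`, the
weights are the traces of `P a * Q b`; they do not depend on the functions. -/
theorem exists_frobenius_weights (A B : Matrix ι ι ℂ) (hA : IsStarNormal A)
    (hB : IsStarNormal B) :
    ∃ w : ℂ → ℂ → ℝ, (∀ a b, 0 ≤ w a b) ∧ ∀ g k : ℂ → ℂ,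
      ‖frobVec (cfc g A - cfc k B)‖ ^ 2 =
        ∑ a ∈ (Matrix.finite_spectrum A).toFinset, ∑ b ∈ (Matrix.finite_spectrum B).toFinset,
          w a b * ‖g a - k b‖ ^ 2 := by
  obtain ⟨P, hPs, hPi, hPo, hP⟩ := exists_spectral_projections A
  obtain ⟨Q, hQs, hQi, hQo, hQ⟩ := exists_spectral_projections B
  set S := (Matrix.finite_spectrum A).toFinset
  set T := (Matrix.finite_spectrum B).toFinset
  have hP1 : ∑ a ∈ S, P a = 1 := by
    have := hP fun _ => 1
    rw [cfc_const_one ℂ A hA] at this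
    simpa using this.symm
  have hQ1 : ∑ b ∈ T, Q b = 1 := by
    have := hQ fun _ => 1
    rw [cfc_const_one ℂ B hB] at this
    simpa using this.symm
  have hw : ∀ a b, ‖frobVec (P a * Q b)‖ ^ 2 = (P a * Q b).trace.re := fun a b => by
    rw [norm_frobVec_sq, star_mul, hPs, hQs, mul_assoc, ← mul_assoc (P a), hPi,
      Matrix.trace_mul_comm, mul_assoc, hQi]
  refine ⟨fun a b => ‖frobVec (P a * Q b)‖ ^ 2, fun a b => by positivity, fun g k => ?_⟩
  have hX : cfc g A - cfc k B = ∑ a ∈ S, ∑ b ∈ T, (g a - k b) • (P a * Q b) := by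
    simp only [sub_smul, Finset.sum_sub_distrib]
    congr 1
    · rw [hP g]
      refine Finset.sum_congr rfl fun a _ => ?_
      rw [← Finset.smul_sum, ← Finset.mul_sum, hQ1, mul_one]
    · rw [hQ k, Finset.sum_comm]
      refine Finset.sum_congr rfl fun b _ => ?_
      rw [← Finset.smul_sum, ← Finset.sum_mul, hP1, one_mul]
  have hsX : star (cfc g A - cfc k B) = ∑ a ∈ S, ∑ b ∈ T, star (g a - k b) • (Q b * P a) := by
    rw [hX]
    simp only [star_sum, star_smul, star_mul, hPs, hQs]
  -- `P a` on the left selects the terms with first index `a`, under the trace `Q b` likewise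
  have key : ∀ a ∈ S, ∀ b ∈ T, (Q b * P a * (cfc g A - cfc k B)).trace
      = (g a - k b) * (P a * Q b).trace := by
    intro a ha b hb
    have h1 : P a * (cfc g A - cfc k B) = ∑ b' ∈ T, (g a - k b') • (P a * Q b') := by
      rw [hX, Finset.mul_sum, Finset.sum_eq_single a]
      · rw [Finset.mul_sum]
        refine Finset.sum_congr rfl fun b' _ => ?_
        rw [mul_smul_comm, ← mul_assoc, hPi]
      · intro a' _ ha'
        rw [Finset.mul_sum]
        refine Finset.sum_eq_zero fun b' _ => ?_
        rw [mul_smul_comm, ← mul_assoc, hPo _ _ ha'.symm, zero_mul, smul_zero]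
      · exact fun h => absurd ha h
    rw [mul_assoc, Matrix.trace_mul_comm, h1, Finset.sum_mul, Finset.sum_eq_single b]
    · rw [smul_mul_assoc, mul_assoc, hQi, Matrix.trace_smul, smul_eq_mul]
    · intro b' _ hb'
      rw [smul_mul_assoc, mul_assoc, hQo _ _ hb', mul_zero, smul_zero]
    · exact fun h => absurd hb h
  rw [norm_frobVec_sq, hsX, Finset.sum_mul, Matrix.trace_sum, Complex.re_sum]
  refine Finset.sum_congr rfl fun a ha => ?_
  rw [Finset.sum_mul, Matrix.trace_sum, Complex.re_sum]
  refine Finset.sum_congr rfl fun b hb => ?_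
  rw [smul_mul_assoc, Matrix.trace_smul, key a ha b hb, smul_eq_mul, ← mul_assoc, Complex.star_def,
    Complex.conj_mul', ← Complex.ofReal_pow, Complex.re_ofReal_mul, ← hw, mul_comm]

open scoped Matrix.Norms.L2Operator in
/-- A comparison of scalar functions on pairs of eigenvalues passes to the Frobenius distance of
functions of normal matrices. -/
theorem dist_frobVec_cfc_le (A B : Matrix ι ι ℂ) (hA : IsStarNormal A) (hB : IsStarNormal B)
    {L : ℝ} (hL : 0 ≤ L) (g k g' k' : ℂ → ℂ)
    (h : ∀ a ∈ spectrum ℂ A, ∀ b ∈ spectrum ℂ B, ‖g a - k b‖ ≤ L * ‖g' a - k' b‖) :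
    dist (frobVec (cfc g A)) (frobVec (cfc k B)) ≤
      L * dist (frobVec (cfc g' A)) (frobVec (cfc k' B)) := by
  obtain ⟨w, hw, hf⟩ := exists_frobenius_weights A B hA hB
  rw [dist_eq_norm, dist_eq_norm, ← frobVec_sub, ← frobVec_sub]
  refine le_of_sq_le_sq ?_ (by positivity)
  rw [mul_pow, hf, hf, Finset.mul_sum]
  refine Finset.sum_le_sum fun a ha => ?_
  rw [Finset.mul_sum]
  refine Finset.sum_le_sum fun b hb => ?_
  have := h a ((Matrix.finite_spectrum A).mem_toFinset.1 ha) b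
    ((Matrix.finite_spectrum B).mem_toFinset.1 hb)
  calc w a b * ‖g a - k b‖ ^ 2 ≤ w a b * (L * ‖g' a - k' b‖) ^ 2 := by
        gcongr
        exact hw a b
    _ = _ := by ring

end Frobenius

/-! ### Scalar estimates -/

theorem cayley_coe (x : ℝ) : cayley (x : EReal) = (1 + Complex.I * x) / (1 - Complex.I * x) := by
  simp [cayley]

theorem cayley_bot : cayley ⊥ = -1 := by simp [cayley]

theorem one_sub_I_mul_ne_zero (x : ℝ) : (1 - Complex.I * x : ℂ) ≠ 0 := fun h => by
  simpa using congrArg Complex.re h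

theorem norm_one_sub_I_mul_sq (x : ℝ) : ‖(1 - Complex.I * x : ℂ)‖ ^ 2 = 1 + x ^ 2 := by
  rw [← Complex.normSq_eq_norm_sq, Complex.normSq_apply]
  simp
  ring

theorem norm_cayley_coe_sub_coe_sq (x y : ℝ) :
    ‖cayley (x : EReal) - cayley (y : EReal)‖ ^ 2
      = 4 * (x - y) ^ 2 / ((1 + x ^ 2) * (1 + y ^ 2)) := by
  have hx := one_sub_I_mul_ne_zero x
  have hy := one_sub_I_mul_ne_zero y
  have : cayley (x : EReal) - cayley (y : EReal)
      = 2 * Complex.I * ((x - y : ℝ) : ℂ) / ((1 - Complex.I * x) * (1 - Complex.I * y)) := by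
    rw [cayley_coe, cayley_coe, div_sub_div _ _ hx hy]
    congr 1
    push_cast
    ring
  rw [this, norm_div, div_pow, norm_mul, mul_pow, norm_mul, mul_pow, norm_mul (1 - _ : ℂ),
    mul_pow, norm_one_sub_I_mul_sq, norm_one_sub_I_mul_sq, Complex.norm_real]
  simp
  norm_num

theorem norm_cayley_coe_sub_bot_sq (x : ℝ) :
    ‖cayley (x : EReal) - cayley ⊥‖ ^ 2 = 4 / (1 + x ^ 2) := by
  have hx := one_sub_I_mul_ne_zero x
  have : cayley (x : EReal) - cayley ⊥ = 2 / (1 - Complex.I * x) := by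
    rw [cayley_coe, cayley_bot]
    field_simp
    ring
  rw [this, norm_div, div_pow, norm_one_sub_I_mul_sq]
  norm_num

/-- Rescaling the argument of the Cayley function is Lipschitz for the chordal metric. -/
theorem norm_cayley_mul_sub_le {θ L : ℝ} (hθ : 0 < θ) (hθL : θ ≤ L) (hL1 : 1 ≤ L)
    (hLθ : 1 ≤ L * θ) {x y : EReal} (hx : x ≠ ⊤) (hy : y ≠ ⊤) :
    ‖cayley ((θ : EReal) * x) - cayley ((θ : EReal) * y)‖ ≤ L * ‖cayley x - cayley y‖ := by
  have hL : 0 < L := by linarith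
  have hbot : ∀ x : ℝ, ‖cayley ((θ : EReal) * x) - cayley ((θ : EReal) * ⊥)‖
      ≤ L * ‖cayley x - cayley ⊥‖ := by
    intro x
    refine le_of_sq_le_sq ?_ (by positivity)
    rw [EReal.coe_mul_bot_of_pos hθ, ← EReal.coe_mul, mul_pow, norm_cayley_coe_sub_bot_sq,
      norm_cayley_coe_sub_bot_sq, ← mul_div_assoc, div_le_div_iff₀ (by positivity) (by positivity)]
    have h1 : 1 ≤ L ^ 2 := one_le_pow₀ hL1
    have h2 : 1 ≤ (L * θ) ^ 2 := one_le_pow₀ hLθ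
    nlinarith [sq_nonneg x, mul_le_mul_of_nonneg_right h2 (sq_nonneg x)]
  induction x with
  | top => exact absurd rfl hx
  | bot =>
    induction y with
    | top => exact absurd rfl hy
    | bot => simp
    | coe y =>
      rw [norm_sub_rev, norm_sub_rev (cayley ⊥)]
      exact hbot y
  | coe x =>
    induction y with
    | top => exact absurd rfl hy
    | bot => exact hbot x
    | coe y =>
      refine le_of_sq_le_sq ?_ (by positivity)
      rw [← EReal.coe_mul, ← EReal.coe_mul, mul_pow, norm_cayley_coe_sub_coe_sq,
        norm_cayley_coe_sub_coe_sq, ← mul_div_assoc,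
        div_le_div_iff₀ (by positivity) (by positivity)]
      have key : ∀ t : ℝ, θ * (1 + t ^ 2) ≤ L * (1 + (θ * t) ^ 2) := fun t => by
        have : θ * 1 ≤ θ * (L * θ) := mul_le_mul_of_nonneg_left hLθ hθ.le
        nlinarith [sq_nonneg t, mul_le_mul_of_nonneg_right this (sq_nonneg t)]
      have h := mul_le_mul (key x) (key y) (by positivity) (by positivity)
      calc 4 * (θ * x - θ * y) ^ 2 * ((1 + x ^ 2) * (1 + y ^ 2))
          = 4 * (x - y) ^ 2 * (θ * (1 + x ^ 2) * (θ * (1 + y ^ 2))) := by ring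
        _ ≤ 4 * (x - y) ^ 2 * (L * (1 + (θ * x) ^ 2) * (L * (1 + (θ * y) ^ 2))) := by gcongr
        _ = _ := by ring

theorem cayleyInv_ne_top (z : ℂ) : cayleyInv z ≠ ⊤ := by
  unfold cayleyInv
  split_ifs
  · simp
  · exact EReal.coe_ne_top _

/-- The distance of phases grows at most by the factor `L` under `f x ↦ f (θ x)`. -/
theorem norm_cayleyScale_sub_le {θ L : ℝ} (hθ : 0 < θ) (hθL : θ ≤ L) (hL1 : 1 ≤ L)
    (hLθ : 1 ≤ L * θ) {z w : ℂ} (hz : ‖z‖ = 1) (hw : ‖w‖ = 1) :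
    ‖cayleyScale θ z - cayleyScale θ w‖ ≤ L * ‖z - w‖ := by
  have := norm_cayley_mul_sub_le hθ hθL hL1 hLθ (cayleyInv_ne_top z) (cayleyInv_ne_top w)
  rwa [cayley_cayleyInv hz, cayley_cayleyInv hw] at this

/-- The distance of phases shrinks at most by the factor `L` under `f x ↦ f (θ x)`, the inverse of
which is the rescaling by `θ⁻¹`. -/
theorem norm_sub_le_cayleyScale {θ L : ℝ} (hθ : 0 < θ) (hθL : θ ≤ L) (hL1 : 1 ≤ L)
    (hLθ : 1 ≤ L * θ) {z w : ℂ} (hz : ‖z‖ = 1) (hw : ‖w‖ = 1) :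
    ‖z - w‖ ≤ L * ‖cayleyScale θ z - cayleyScale θ w‖ := by
  have hinv : ∀ x : EReal, ((θ⁻¹ : ℝ) : EReal) * ((θ : EReal) * x) = x := fun x => by
    rw [← mul_assoc, ← EReal.coe_mul, inv_mul_cancel₀ hθ.ne', EReal.coe_one, one_mul]
  have htop : ∀ z, (θ : EReal) * cayleyInv z ≠ ⊤ := fun z h => by
    have := hinv (cayleyInv z)
    rw [h, EReal.coe_mul_top_of_pos (inv_pos.2 hθ)] at this
    exact cayleyInv_ne_top z this.symm
  have h := norm_cayley_mul_sub_le (θ := θ⁻¹) (L := L) (inv_pos.2 hθ)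
    (by rw [inv_le_iff_one_le_mul₀ hθ]; exact hLθ) hL1
    (by rw [← div_eq_mul_inv, le_div_iff₀ hθ]; simpa using hθL) (htop z) (htop w)
  rwa [hinv, hinv, cayley_cayleyInv hz, cayley_cayleyInv hw] at h

theorem norm_exp_mul_I_sub (x y : ℝ) :
    ‖Complex.exp (Complex.I * x) - Complex.exp (Complex.I * y)‖ = 2 * |Real.sin ((x - y) / 2)| := by
  have : Complex.exp (Complex.I * x) - Complex.exp (Complex.I * y)
      = Complex.exp (y * Complex.I) * (Complex.exp (Complex.I * ((x - y : ℝ) : ℂ)) - 1) := by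
    rw [mul_sub, ← Complex.exp_add, mul_one]
    congr 2
    · push_cast
      ring
    · ring
  rw [this, norm_mul, Complex.norm_exp_ofReal_mul_I, one_mul,
    Complex.norm_exp_I_mul_ofReal_sub_one]
  simp

theorem norm_exp_mul_I_sub_le (x y : ℝ) :
    ‖Complex.exp (Complex.I * x) - Complex.exp (Complex.I * y)‖ ≤ |x - y| := by
  rw [norm_exp_mul_I_sub]
  have := Real.abs_sin_le_abs (x := (x - y) / 2)
  rw [abs_div, abs_of_pos (zero_lt_two' ℝ)] at this
  linarith

theorem abs_sub_le_norm_exp_mul_I_sub {x y : ℝ} (hx : |x| ≤ 1) (hy : |y| ≤ 1) :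
    |x - y| ≤ 2 * ‖Complex.exp (Complex.I * x) - Complex.exp (Complex.I * y)‖ := by
  rw [norm_exp_mul_I_sub]
  rw [abs_le] at hx hy
  have h := Real.mul_abs_le_abs_sin (x := (x - y) / 2) (by
    rw [abs_le]
    constructor <;> linarith [Real.pi_gt_three])
  have hp : 1 / 2 ≤ 2 / Real.pi := by
    rw [div_le_div_iff₀ two_pos Real.pi_pos]
    linarith [Real.pi_le_four]
  have := mul_le_mul_of_nonneg_right hp (abs_nonneg ((x - y) / 2))
  have e : |(x - y) / 2| = |x - y| / 2 := by rw [abs_div, abs_of_pos (zero_lt_two' ℝ)]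
  rw [e] at this h
  linarith

/-! ### Haar measure as Hausdorff measure -/

section HaarHausdorff

open scoped NNReal ENNReal

variable {ι : Type*} [Fintype ι]

/-- The Hermitian matrices, as a real subspace of the Euclidean space of all matrices. -/
noncomputable def hermitianVec (ι : Type*) [Fintype ι] :
    Submodule ℝ (EuclideanSpace ℂ (ι × ι)) where
  carrier := {x | ∀ i j, star (x (j, i)) = x (i, j)}
  add_mem' hx hy i j := by simp [← hx i j, ← hy i j]
  zero_mem' i j := by simp
  smul_mem' c x hx i j := by simp [← hx i j]

/-- The Hermitian matrix with a given vector of entries. -/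
noncomputable def hermitianMatrix (x : hermitianVec ι) : Matrix ι ι ℂ :=
  Matrix.of fun i j => (x : EuclideanSpace ℂ (ι × ι)) (i, j)

theorem frobVec_hermitianMatrix (x : hermitianVec ι) : frobVec (hermitianMatrix x) = x := rfl

theorem hermitianMatrix_isSelfAdjoint (x : hermitianVec ι) : IsSelfAdjoint (hermitianMatrix x) := by
  ext i j
  exact x.2 i j

theorem exists_hermitianVec {A : Matrix ι ι ℂ} (hA : IsSelfAdjoint A) :
    ∃ x : hermitianVec ι, hermitianMatrix x = A :=
  ⟨⟨frobVec A, fun i j => congrFun (congrFun hA i) j⟩, rfl⟩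

variable [DecidableEq ι]

theorem isEmbedding_frobVec_coe :
    Topology.IsEmbedding fun U : Matrix.unitaryGroup ι ℂ => frobVec (U : Matrix ι ι ℂ) := by
  refine (Continuous.isClosedEmbedding ?_ ?_).isEmbedding
  · refine (PiLp.continuous_toLp 2 _).comp (continuous_pi fun p => ?_)
    exact continuous_subtype_val.matrix_elem p.1 p.2
  · exact fun U V h => Subtype.ext (frobVec_injective h)

instance secondCountableTopology_unitaryGroup :
    SecondCountableTopology (Matrix.unitaryGroup ι ℂ) :=
  isEmbedding_frobVec_coe.secondCountableTopology

/-- The Frobenius distance on the unitary group; it induces the given topology. -/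
@[reducible] noncomputable def unitaryMetric : MetricSpace (Matrix.unitaryGroup ι ℂ) :=
  isEmbedding_frobVec_coe.comapMetricSpace _

attribute [local instance] unitaryMetric

theorem unitary_dist_eq (U V : Matrix.unitaryGroup ι ℂ) :
    dist U V = dist (frobVec (U : Matrix ι ι ℂ)) (frobVec (V : Matrix ι ι ℂ)) := rfl

instance isIsometricSMul_unitaryGroup :
    IsIsometricSMul (Matrix.unitaryGroup ι ℂ) (Matrix.unitaryGroup ι ℂ) where
  isometry_smul U := Isometry.of_dist_eq fun V W => by
    have hU : star (U : Matrix ι ι ℂ) * U = 1 := Matrix.mem_unitaryGroup_iff'.1 U.2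
    rw [unitary_dist_eq, unitary_dist_eq, dist_eq_norm, dist_eq_norm, ← frobVec_sub,
      ← frobVec_sub, ← sq_eq_sq₀ (norm_nonneg _) (norm_nonneg _), norm_frobVec_sq,
      norm_frobVec_sq]
    change (star ((U : Matrix ι ι ℂ) * V - U * W) * ((U : Matrix ι ι ℂ) * V - U * W)).trace.re = _
    rw [← mul_sub, star_mul, mul_assoc, ← mul_assoc (star (U : Matrix ι ι ℂ)), hU, one_mul]

theorem star_mul_self_exp_mul_I (x : ℝ) :
    star (Complex.exp (Complex.I * x)) * Complex.exp (Complex.I * x) = 1 := by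
  rw [Complex.star_def, Complex.conj_mul', mul_comm, Complex.norm_exp_ofReal_mul_I]
  simp

open scoped Matrix.Norms.L2Operator in
theorem ofReal_re_of_mem_spectrum_hermitianMatrix (x : hermitianVec ι) {z : ℂ}
    (hz : z ∈ spectrum ℂ (hermitianMatrix x)) : ((z.re : ℝ) : ℂ) = z :=
  ((hermitianMatrix_isSelfAdjoint x).mem_spectrum_eq_re hz).symm

open scoped Matrix.Norms.L2Operator in
/-- The unitary `exp (i h)` for a Hermitian matrix `h`. -/
noncomputable def expHermitian (x : hermitianVec ι) : Matrix.unitaryGroup ι ℂ :=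
  ⟨cfc (fun z => Complex.exp (Complex.I * z)) (hermitianMatrix x), by
    refine (cfc_unitary_iff _ _ (hermitianMatrix_isSelfAdjoint x).isStarNormal
      (continuousOn_spectrum_matrix _ _)).2 fun z hz => ?_
    rw [← ofReal_re_of_mem_spectrum_hermitianMatrix x hz]
    exact star_mul_self_exp_mul_I _⟩

open scoped Matrix.Norms.L2Operator in
/-- The distance of Hermitian matrices in the form to which `dist_frobVec_cfc_le` applies. -/
theorem dist_hermitianVec_eq (x y : hermitianVec ι) :
    dist x y = dist (frobVec (cfc (fun z : ℂ => z) (hermitianMatrix x)))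
      (frobVec (cfc (fun z : ℂ => z) (hermitianMatrix y))) := by
  rw [cfc_id' ℂ (hermitianMatrix x) (hermitianMatrix_isSelfAdjoint x).isStarNormal,
    cfc_id' ℂ (hermitianMatrix y) (hermitianMatrix_isSelfAdjoint y).isStarNormal]
  rfl

theorem lipschitzWith_expHermitian : LipschitzWith 1 (expHermitian (ι := ι)) :=
  LipschitzWith.of_dist_le_mul fun x y => by
    rw [dist_hermitianVec_eq x]
    refine dist_frobVec_cfc_le _ _ (hermitianMatrix_isSelfAdjoint x).isStarNormal
      (hermitianMatrix_isSelfAdjoint y).isStarNormal zero_le_one _ _ _ _ fun a ha b hb => ?_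
    rw [← ofReal_re_of_mem_spectrum_hermitianMatrix x ha,
      ← ofReal_re_of_mem_spectrum_hermitianMatrix y hb, ← Complex.ofReal_sub,
      Complex.norm_real, one_mul]
    exact norm_exp_mul_I_sub_le _ _

open scoped Matrix.Norms.L2Operator in
/-- The Hermitian matrices of operator norm less than one. -/
noncomputable def hermitianBall (ι : Type*) [Fintype ι] [DecidableEq ι] : Set (hermitianVec ι) :=
  {x | ‖hermitianMatrix x‖ < 1}

open scoped Matrix.Norms.L2Operator in
theorem isOpen_hermitianBall : IsOpen (hermitianBall ι) := by
  have h : Continuous fun x : hermitianVec ι => hermitianMatrix x := by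
    refine continuous_matrix fun i j => ?_
    exact (PiLp.continuous_apply 2 _ (i, j)).comp continuous_subtype_val
  exact isOpen_lt (continuous_norm.comp h) continuous_const

open scoped Matrix.Norms.L2Operator in
theorem zero_mem_hermitianBall : (0 : hermitianVec ι) ∈ hermitianBall ι := by
  change ‖(0 : Matrix ι ι ℂ)‖ < 1
  rw [norm_zero]
  exact one_pos

open scoped Matrix.Norms.L2Operator in
theorem abs_re_le_one_of_mem_hermitianBall {x : hermitianVec ι} (hx : x ∈ hermitianBall ι) {z : ℂ}
    (hz : z ∈ spectrum ℂ (hermitianMatrix x)) : |z.re| ≤ 1 := by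
  have hx : ‖hermitianMatrix x‖ < 1 := hx
  cases isEmpty_or_nonempty ι
  · exact absurd hz (by simp)
  · exact (Complex.abs_re_le_norm z).trans ((spectrum.norm_le_norm_of_mem hz).trans hx.le)

theorem antilipschitzWith_expHermitian_restrict :
    AntilipschitzWith 2 fun x : hermitianBall ι => expHermitian (x : hermitianVec ι) := by
  refine AntilipschitzWith.of_le_mul_dist fun x y => ?_
  rw [Subtype.dist_eq, dist_hermitianVec_eq]
  refine dist_frobVec_cfc_le _ _ (hermitianMatrix_isSelfAdjoint _).isStarNormal
    (hermitianMatrix_isSelfAdjoint _).isStarNormal zero_le_two _ _ _ _ fun a ha b hb => ?_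
  have h := abs_sub_le_norm_exp_mul_I_sub (abs_re_le_one_of_mem_hermitianBall x.2 ha)
    (abs_re_le_one_of_mem_hermitianBall y.2 hb)
  rwa [← Real.norm_eq_abs, ← Complex.norm_real, Complex.ofReal_sub,
    ofReal_re_of_mem_spectrum_hermitianMatrix _ ha,
    ofReal_re_of_mem_spectrum_hermitianMatrix _ hb] at h

open scoped Matrix.Norms.L2Operator in
/-- Every unitary is `exp (i h)` for some `h` in a fixed ball: take `h = arg U`. -/
theorem expHermitian_surjOn :
    ∃ r : ℝ, ∀ U : Matrix.unitaryGroup ι ℂ, ∃ x : hermitianVec ι, ‖x‖ ≤ r ∧ expHermitian x = U := by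
  refine ⟨Real.pi * ‖frobVec (1 : Matrix ι ι ℂ)‖, fun U => ?_⟩
  have hU : IsStarNormal (U : Matrix ι ι ℂ) := isStarNormal_of_mem_unitary U.2
  obtain ⟨x, hx⟩ := exists_hermitianVec (A := cfc (fun z => (Complex.arg z : ℂ)) (U : Matrix ι ι ℂ))
    (by
      rw [isSelfAdjoint_iff, ← cfc_star]
      simp)
  refine ⟨x, ?_, Subtype.ext ?_⟩
  · have h := dist_frobVec_cfc_le (U : Matrix ι ι ℂ) U hU hU Real.pi_pos.le
      (fun z => (Complex.arg z : ℂ)) (fun _ => 0) (fun _ => 1) (fun _ => 0) (fun a _ b _ => by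
        simpa using Complex.abs_arg_le_pi a)
    rw [← hx, cfc_const_one ℂ _ hU, cfc_const_zero, frobVec_hermitianMatrix x, dist_eq_norm,
      dist_eq_norm, ← frobVec_hermitianMatrix x, ← frobVec_sub, ← frobVec_sub, sub_zero, sub_zero] at h
    exact h
  · change cfc _ (hermitianMatrix x) = _
    rw [hx, ← cfc_comp' _ _ _ (((Matrix.finite_spectrum _).image _).continuousOn _)
      (continuousOn_spectrum_matrix _ _) hU]
    conv_rhs => rw [← cfc_id' ℂ (U : Matrix ι ι ℂ) hU]
    refine cfc_congr fun z hz => ?_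
    have hz1 : ‖z‖ = 1 :=
      CStarRing.norm_of_mem_unitary (spectrum_subset_unitary_of_mem_unitary U.2 hz)
    have := Complex.norm_mul_exp_arg_mul_I z
    rw [hz1, Complex.ofReal_one, one_mul, mul_comm] at this
    exact this

/-- The dimension of the unitary group as a real manifold. -/
noncomputable def unitaryDim (ι : Type*) [Fintype ι] : ℕ := Module.finrank ℝ (hermitianVec ι)

theorem hausdorffMeasure_unitaryGroup_ne_top :
    (μH[unitaryDim ι] : Measure (Matrix.unitaryGroup ι ℂ)) Set.univ ≠ ∞ := by
  obtain ⟨r, hr⟩ := expHermitian_surjOn (ι := ι)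
  have hsub : (Set.univ : Set (Matrix.unitaryGroup ι ℂ)) ⊆
      expHermitian '' Metric.closedBall (0 : hermitianVec ι) r := fun U _ => by
    obtain ⟨x, hx, rfl⟩ := hr U
    exact ⟨x, by simpa using hx, rfl⟩
  refine ne_top_of_le_ne_top ?_ ((measure_mono hsub).trans
    (lipschitzWith_expHermitian.hausdorffMeasure_image_le (Nat.cast_nonneg _) _))
  rw [ENNReal.coe_one, ENNReal.one_rpow, one_mul]
  exact (isCompact_closedBall (0 : hermitianVec ι) r).measure_ne_top
    (μ := (μH[Module.finrank ℝ (hermitianVec ι)] : Measure (hermitianVec ι)))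

theorem hausdorffMeasure_unitaryGroup_ne_zero :
    (μH[unitaryDim ι] : Measure (Matrix.unitaryGroup ι ℂ)) Set.univ ≠ 0 := by
  intro h0
  have h := (antilipschitzWith_expHermitian_restrict (ι := ι)).le_hausdorffMeasure_image
    (d := unitaryDim ι) (Nat.cast_nonneg _) Set.univ
  rw [measure_mono_null (Set.subset_univ _) h0, mul_zero, nonpos_iff_eq_zero,
    ← isometry_subtype_coe.hausdorffMeasure_image (Or.inl (Nat.cast_nonneg _)), Set.image_univ,
    Subtype.range_coe] at h
  refine (isOpen_hermitianBall (ι := ι)).measure_ne_zero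
    (μH[Module.finrank ℝ (hermitianVec ι)] : Measure (hermitianVec ι)) ⟨0, zero_mem_hermitianBall⟩ h

/-- Since the Haar measure is a multiple of the Hausdorff measure of the Frobenius metric, it grows
at most by the factor `K ^ dim` under preimages by maps which contract distances at most by `K`. -/
theorem haarUnitary_preimage_le {φ : Matrix.unitaryGroup ι ℂ → Matrix.unitaryGroup ι ℂ} {K : ℝ≥0}
    (hφ : AntilipschitzWith K φ) (s : Set (Matrix.unitaryGroup ι ℂ)) :
    haarUnitary ι (φ ⁻¹' s) ≤ (K : ℝ≥0∞) ^ unitaryDim ι * haarUnitary ι s := by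
  set c := (μH[unitaryDim ι] : Measure (Matrix.unitaryGroup ι ℂ)) Set.univ with hc
  have htop : c ≠ ∞ := hausdorffMeasure_unitaryGroup_ne_top
  have h0 : c ≠ 0 := hausdorffMeasure_unitaryGroup_ne_zero
  have : IsFiniteMeasure (μH[unitaryDim ι] : Measure (Matrix.unitaryGroup ι ℂ)) :=
    ⟨lt_top_iff_ne_top.2 htop⟩
  have hH : (μH[unitaryDim ι] : Measure (Matrix.unitaryGroup ι ℂ)) = c • haarUnitary ι :=
    Measure.haarMeasure_unique _ ⊤
  have h := hφ.hausdorffMeasure_preimage_le (d := unitaryDim ι) (Nat.cast_nonneg _) s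
  rw [hH, Measure.smul_apply, Measure.smul_apply, smul_eq_mul, smul_eq_mul, ENNReal.rpow_natCast,
    mul_left_comm, ENNReal.mul_le_mul_iff_right h0 htop] at h
  exact h

variable {θ L : ℝ}

theorem norm_of_mem_spectrum_unitary (U : Matrix.unitaryGroup ι ℂ) {z : ℂ}
    (hz : z ∈ spectrum ℂ (U : Matrix ι ι ℂ)) : ‖z‖ = 1 := by
  open scoped Matrix.Norms.L2Operator in
  exact CStarRing.norm_of_mem_unitary (spectrum_subset_unitary_of_mem_unitary U.2 hz)

open scoped Matrix.Norms.L2Operator in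
theorem cfc_id_unitary (U : Matrix.unitaryGroup ι ℂ) : cfc (fun z : ℂ => z) (U : Matrix ι ι ℂ) = U :=
  cfc_id' ℂ (U : Matrix ι ι ℂ) (isStarNormal_of_mem_unitary U.2)

theorem continuous_cayleyPath (hθ : 0 < θ) (hθL : θ ≤ L) (hL1 : 1 ≤ L) (hLθ : 1 ≤ L * θ) :
    Continuous (cayleyPath (ι := ι) θ) := by
  refine (LipschitzWith.of_dist_le_mul (K := ⟨L, by linarith⟩) fun U V => ?_).continuous
  have h := dist_frobVec_cfc_le _ _ (isStarNormal_of_mem_unitary U.2)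
    (isStarNormal_of_mem_unitary V.2) (zero_le_one.trans hL1) (cayleyScale θ) (cayleyScale θ)
    (fun z => z) (fun z => z) fun a ha b hb =>
      norm_cayleyScale_sub_le hθ hθL hL1 hLθ (norm_of_mem_spectrum_unitary U ha)
        (norm_of_mem_spectrum_unitary V hb)
  rwa [cfc_id_unitary, cfc_id_unitary] at h

theorem antilipschitzWith_cayleyPath (hθ : 0 < θ) (hθL : θ ≤ L) (hL1 : 1 ≤ L)
    (hLθ : 1 ≤ L * θ) :
    AntilipschitzWith ⟨L, zero_le_one.trans hL1⟩ (cayleyPath (ι := ι) θ) := by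
  refine AntilipschitzWith.of_le_mul_dist fun U V => ?_
  have h := dist_frobVec_cfc_le _ _ (isStarNormal_of_mem_unitary U.2)
    (isStarNormal_of_mem_unitary V.2) (zero_le_one.trans hL1) (fun z => z) (fun z => z)
    (cayleyScale θ) (cayleyScale θ) fun a ha b hb =>
      norm_sub_le_cayleyScale hθ hθL hL1 hLθ (norm_of_mem_spectrum_unitary U ha)
        (norm_of_mem_spectrum_unitary V hb)
  rwa [cfc_id_unitary, cfc_id_unitary] at h

/-- The law of a deformed Haar random gate is dominated by a multiple of Haar measure. -/
theorem map_mul_cayleyPath_le (hθ : 0 < θ) (hθL : θ ≤ L) (hL1 : 1 ≤ L) (hLθ : 1 ≤ L * θ)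
    (U : Matrix.unitaryGroup ι ℂ) :
    (haarUnitary ι).map (fun H => U * cayleyPath θ H) ≤
      ENNReal.ofReal (L ^ unitaryDim ι) • haarUnitary ι := by
  have hL : 0 ≤ L := by linarith
  have hcont : Continuous fun H : Matrix.unitaryGroup ι ℂ => U * cayleyPath θ H :=
    continuous_const.mul (continuous_cayleyPath hθ hθL hL1 hLθ)
  have hanti : AntilipschitzWith ⟨L, hL⟩
      fun H : Matrix.unitaryGroup ι ℂ => U * cayleyPath θ H := by
    refine AntilipschitzWith.of_le_mul_dist fun V W => ?_
    have : dist (U * cayleyPath θ V) (U * cayleyPath θ W)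
        = dist (cayleyPath θ V) (cayleyPath θ W) := dist_smul U _ _
    rw [this]
    exact (antilipschitzWith_cayleyPath hθ hθL hL1 hLθ).le_mul_dist V W
  refine Measure.le_iff.2 fun s hs => ?_
  rw [Measure.map_apply hcont.measurable hs, Measure.smul_apply, smul_eq_mul,
    ENNReal.ofReal_pow hL]
  refine (haarUnitary_preimage_le hanti s).trans_eq ?_
  congr 2
  exact (ENNReal.ofReal_eq_coe_nnreal hL).symm

end HaarHausdorff

/-! ### Total variation distance and products under domination -/

section TotalVariation

open scoped ENNReal

variable {Ω : Type*} [MeasurableSpace Ω] {μ ν : Measure Ω}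

theorem rnDeriv_le_mul_rnDeriv_of_le_smul [IsFiniteMeasure μ] [IsFiniteMeasure ν] {c : ℝ≥0∞}
    (h : μ ≤ c • ν) :
    μ.rnDeriv (μ + ν) ≤ᵐ[μ + ν] fun x => c * ν.rnDeriv (μ + ν) x := by
  have hμ : μ ≪ μ + ν := Measure.AbsolutelyContinuous.rfl.add_right _
  have hν : ν ≪ μ + ν := Measure.absolutelyContinuous_of_le (Measure.le_add_left le_rfl)
  refine ae_le_of_forall_setLIntegral_le_of_sigmaFinite (Measure.measurable_rnDeriv _ _)
    fun s hs _ => ?_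
  rw [lintegral_const_mul _ (Measure.measurable_rnDeriv _ _), Measure.setLIntegral_rnDeriv hμ,
    Measure.setLIntegral_rnDeriv hν]
  simpa using h s

variable [IsProbabilityMeasure μ] [IsProbabilityMeasure ν]

theorem integral_toReal_rnDeriv_add_left : ∫ x, (μ.rnDeriv (μ + ν) x).toReal ∂(μ + ν) = 1 := by
  rw [Measure.integral_toReal_rnDeriv (Measure.AbsolutelyContinuous.rfl.add_right _)]
  simp

theorem integral_toReal_rnDeriv_add_right : ∫ x, (ν.rnDeriv (μ + ν) x).toReal ∂(μ + ν) = 1 := by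
  rw [Measure.integral_toReal_rnDeriv
    (Measure.absolutelyContinuous_of_le (Measure.le_add_left le_rfl))]
  simp

theorem tvDist_le_one : tvDist μ ν ≤ 1 := by
  have h1 := Measure.integrable_toReal_rnDeriv (μ := μ) (ν := μ + ν)
  have h2 := Measure.integrable_toReal_rnDeriv (μ := ν) (ν := μ + ν)
  have h : ∫ x, |(μ.rnDeriv (μ + ν) x).toReal - (ν.rnDeriv (μ + ν) x).toReal| ∂(μ + ν)
      ≤ ∫ x, ((μ.rnDeriv (μ + ν) x).toReal + (ν.rnDeriv (μ + ν) x).toReal) ∂(μ + ν) := by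
    refine integral_mono (h1.sub h2).abs (h1.add h2) fun x => ?_
    refine (abs_sub _ _).trans_eq ?_
    rw [abs_of_nonneg ENNReal.toReal_nonneg, abs_of_nonneg ENNReal.toReal_nonneg]
  rw [integral_add h1 h2, integral_toReal_rnDeriv_add_left,
    integral_toReal_rnDeriv_add_right] at h
  unfold tvDist
  linarith

/-- For densities `p ≤ c q` of total mass one, `|p - q| = 2 (p - q)⁺ - (p - q)` has integral at most
`2 (c - 1)`. -/
theorem tvDist_le_of_le_smul {c : ℝ} (hc : 1 ≤ c) (h : μ ≤ ENNReal.ofReal c • ν) :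
    tvDist μ ν ≤ c - 1 := by
  have h1 := Measure.integrable_toReal_rnDeriv (μ := μ) (ν := μ + ν)
  have h2 := Measure.integrable_toReal_rnDeriv (μ := ν) (ν := μ + ν)
  have h : ∫ x, |(μ.rnDeriv (μ + ν) x).toReal - (ν.rnDeriv (μ + ν) x).toReal| ∂(μ + ν)
      ≤ ∫ x, ((2 * c - 1) * (ν.rnDeriv (μ + ν) x).toReal - (μ.rnDeriv (μ + ν) x).toReal)
        ∂(μ + ν) := by
    refine integral_mono_ae (h1.sub h2).abs ((h2.const_mul _).sub h1) ?_
    filter_upwards [rnDeriv_le_mul_rnDeriv_of_le_smul h, Measure.rnDeriv_lt_top ν (μ + ν)]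
      with x hx hν
    have hp := ENNReal.toReal_mono (ENNReal.mul_ne_top ENNReal.ofReal_ne_top hν.ne) hx
    rw [ENNReal.toReal_mul, ENNReal.toReal_ofReal (by linarith)] at hp
    have hq : 0 ≤ (ν.rnDeriv (μ + ν) x).toReal := ENNReal.toReal_nonneg
    have hcq := mul_le_mul_of_nonneg_right hc hq
    rw [abs_le]
    constructor <;> nlinarith
  rw [integral_sub (h2.const_mul _) h1, integral_const_mul, integral_toReal_rnDeriv_add_left,
    integral_toReal_rnDeriv_add_right] at h
  unfold tvDist
  linarith

end TotalVariation

section Products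

open scoped ENNReal

/-- Domination of each factor by a finite multiple gives domination of product measures. -/
theorem pi_le_smul_pi {κ : Type*} [Fintype κ] {X : κ → Type*} [∀ k, MeasurableSpace (X k)]
    {μ ν : ∀ k, Measure (X k)} [∀ k, SigmaFinite (μ k)] [∀ k, SigmaFinite (ν k)] {c : ℝ≥0∞}
    (hc0 : c ≠ 0) (hc : c ≠ ∞) (h : ∀ k, μ k ≤ c • ν k) :
    Measure.pi μ ≤ c ^ Fintype.card κ • Measure.pi ν := by
  have hC0 : c ^ Fintype.card κ ≠ 0 := pow_ne_zero _ hc0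
  have hC : c ^ Fintype.card κ ≠ ∞ := ENNReal.pow_ne_top hc
  -- The outer measure of `ν` is the largest one bounded by `∏ k, ν k (s k)` on boxes, so it is
  -- enough to compare boxes once the factor has been moved to the left.
  have key : (c ^ Fintype.card κ)⁻¹ • (Measure.pi μ).toOuterMeasure ≤
      OuterMeasure.pi fun k => (ν k).toOuterMeasure := by
    refine OuterMeasure.le_pi.2 fun s _ => ?_
    change (c ^ Fintype.card κ)⁻¹ * Measure.pi μ (Set.univ.pi s) ≤ ∏ k, ν k (s k)
    rw [Measure.pi_pi, ENNReal.inv_mul_le_iff hC0 hC]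
    calc ∏ k, μ k (s k) ≤ ∏ k, c * ν k (s k) := Finset.prod_le_prod' fun k _ => h k (s k)
      _ = _ := by rw [Finset.prod_mul_distrib, Finset.prod_const, Finset.card_univ]
  refine Measure.le_iff.2 fun s hs => ?_
  have h1 : (c ^ Fintype.card κ)⁻¹ * Measure.pi μ s ≤
      OuterMeasure.pi (fun k => (ν k).toOuterMeasure) s := key s
  have h2 : Measure.pi ν s = OuterMeasure.pi (fun k => (ν k).toOuterMeasure) s := by
    rw [Measure.pi, toMeasure_apply _ _ hs]
  rw [Measure.smul_apply, smul_eq_mul, h2]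
  exact (ENNReal.inv_mul_le_iff hC0 hC).1 h1

end Products

/-! ### Circuits -/

theorem continuous_applyOnWires {q n : ℕ} (w : Fin q ↪ Fin n) : Continuous (applyOnWires w) := by
  refine Continuous.subtype_mk ?_ _
  refine continuous_matrix fun i j => ?_
  simp only [Matrix.reindex_apply, Matrix.submatrix_apply, Matrix.kroneckerMap_apply]
  exact (continuous_subtype_val.matrix_elem _ _).mul continuous_const

theorem Architecture.measurable_unitaryOf {n m : ℕ} (A : Architecture n m) :
    Measurable A.unitaryOf := by
  refine Continuous.measurable ?_
  unfold Architecture.unitaryOf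
  simp only [List.ofFn_eq_map, ← List.map_reverse]
  exact continuous_list_prod _ fun k _ => (continuous_applyOnWires _).comp (continuous_apply k)

/-- A power `(1 + a) ^ N` with `N * a` small is linearly close to one; for `N * a` large the trivial
bound takes over. -/
theorem min_one_add_pow_sub_one_le {a : ℝ} (ha : 0 ≤ a) (N : ℕ) :
    min 1 ((1 + a) ^ N - 1) ≤ 2 * (N * a) := by
  have hNa : 0 ≤ N * a := by positivity
  rcases le_or_gt (N * a) 1 with h | h
  · refine (min_le_right _ _).trans ?_
    have h1 : (1 + a) ^ N ≤ Real.exp (N * a) := by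
      rw [Real.exp_nat_mul]
      exact pow_le_pow_left₀ (by positivity) (by linarith [Real.add_one_le_exp a]) N
    have h2 := Real.abs_exp_sub_one_le (x := N * a) (by rwa [abs_of_nonneg hNa])
    rw [abs_of_nonneg hNa] at h2
    linarith [le_abs_self (Real.exp (N * a) - 1)]
  · exact (min_le_left _ _).trans (by linarith)

namespace Architecture

variable {n m : ℕ} (A : Architecture n m)

instance : IsProbabilityMeasure A.haarCircuit := by
  unfold haarCircuit
  infer_instance

theorem unitaryDim_arity_le (k : Fin m) :
    unitaryDim (Fin (A.arity k) → Fin 2) ≤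
      unitaryDim (Fin 1 → Fin 2) + unitaryDim (Fin 2 → Fin 2) := by
  rcases A.arity_eq k with h | h <;> rw [h] <;> omega

variable {θ L : ℝ}

theorem measurable_cayleyCircuit (hθ : 0 < θ) (hθL : θ ≤ L) (hL1 : 1 ≤ L) (hLθ : 1 ≤ L * θ)
    (C : A.Circuit) : Measurable (A.cayleyCircuit C θ) := by
  refine measurable_pi_lambda _ fun k => Measurable.comp (g := fun H => C k * cayleyPath θ H)
    (Continuous.measurable ?_) (measurable_pi_apply k)
  exact continuous_const.mul (continuous_cayleyPath hθ hθL hL1 hLθ)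

/-- The deformed Haar distribution of circuits is dominated by a multiple of the Haar distribution.
The factor depends on the architecture only through the number of gates, as a gate acts on one or
two qubits. -/
theorem deformedHaar_le (hθ : 0 < θ) (hθL : θ ≤ L) (hL1 : 1 ≤ L) (hLθ : 1 ≤ L * θ)
    (C : A.Circuit) :
    A.deformedHaar C θ ≤ ENNReal.ofReal (L ^
      ((unitaryDim (Fin 1 → Fin 2) + unitaryDim (Fin 2 → Fin 2)) * m)) • A.haarCircuit := by
  have hmeas : ∀ k, Measurable fun H : QubitUnitary (A.arity k) => C k * cayleyPath θ H :=
    fun k => (continuous_const.mul (continuous_cayleyPath hθ hθL hL1 hLθ)).measurable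
  have : ∀ k, IsProbabilityMeasure
      ((haarUnitary (Fin (A.arity k) → Fin 2)).map fun H => C k * cayleyPath θ H) :=
    fun k => Measure.isProbabilityMeasure_map (hmeas k).aemeasurable
  have hpi : A.deformedHaar C θ = Measure.pi fun k =>
      (haarUnitary (Fin (A.arity k) → Fin 2)).map fun H => C k * cayleyPath θ H :=
    Measure.pi_map_pi fun k => (hmeas k).aemeasurable
  have h := pi_le_smul_pi (c := ENNReal.ofReal (L ^
      (unitaryDim (Fin 1 → Fin 2) + unitaryDim (Fin 2 → Fin 2))))
    (ENNReal.ofReal_pos.2 (by positivity)).ne' ENNReal.ofReal_ne_top fun k =>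
      (map_mul_cayleyPath_le hθ hθL hL1 hLθ (C k)).trans
        (Measure.le_iff'.2 fun s => by
          rw [Measure.smul_apply, Measure.smul_apply, smul_eq_mul, smul_eq_mul]
          gcongr
          exact A.unitaryDim_arity_le k)
  rw [hpi, pow_mul, ENNReal.ofReal_pow (by positivity)]
  rwa [Fintype.card_fin] at h

end Architecture

theorem mainTheorem5 :
    ∃ K Δ₀ : ℝ, 0 < K ∧ 0 < Δ₀ ∧
      ∀ (n m : ℕ) (A : Architecture n m) (C : A.Circuit) (θ Δ : ℝ),
        Δ ≤ Δ₀ → |1 - θ| ≤ Δ →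
          tvDist (A.deformedHaar C θ) A.haarCircuit ≤ K * (m * Δ) ∧
          tvDist ((A.deformedHaar C θ).map A.unitaryOf) (A.haarCircuit.map A.unitaryOf)
            ≤ K * (m * Δ) := by
  set D := unitaryDim (Fin 1 → Fin 2) + unitaryDim (Fin 2 → Fin 2)
  refine ⟨4 * D + 1, 1 / 2, by positivity, by norm_num, fun n m A C θ Δ hΔ hθΔ => ?_⟩
  have hΔ0 : 0 ≤ Δ := (abs_nonneg _).trans hθΔ
  rw [abs_le] at hθΔ
  have hθ : 0 < θ := by linarith
  have hθL : θ ≤ 1 + 2 * Δ := by linarith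
  have hL1 : 1 ≤ 1 + 2 * Δ := by linarith
  -- `(1 + 2 Δ) (1 - Δ) = 1 + Δ (1 - 2 Δ)`
  have hLθ : 1 ≤ (1 + 2 * Δ) * θ := by nlinarith
  have hle := A.deformedHaar_le hθ hθL hL1 hLθ C
  have hprob : IsProbabilityMeasure (A.deformedHaar C θ) :=
    Measure.isProbabilityMeasure_map (A.measurable_cayleyCircuit hθ hθL hL1 hLθ C).aemeasurable
  have hU := A.measurable_unitaryOf
  have hprob1 : IsProbabilityMeasure ((A.deformedHaar C θ).map A.unitaryOf) :=
    Measure.isProbabilityMeasure_map hU.aemeasurable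
  have hprob2 : IsProbabilityMeasure (A.haarCircuit.map A.unitaryOf) :=
    Measure.isProbabilityMeasure_map hU.aemeasurable
  have hleU := Measure.map_mono hle hU
  rw [Measure.map_smul] at hleU
  have hnum : min 1 ((1 + 2 * Δ) ^ (D * m) - 1) ≤ (4 * D + 1) * (m * Δ) := by
    refine (min_one_add_pow_sub_one_le (by positivity) _).trans ?_
    have : 0 ≤ (m : ℝ) * Δ := by positivity
    push_cast
    linarith
  have hpow : 1 ≤ (1 + 2 * Δ) ^ (D * m) := one_le_pow₀ hL1
  exact ⟨(le_min tvDist_le_one (tvDist_le_of_le_smul hpow hle)).trans hnum,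
    (le_min tvDist_le_one (tvDist_le_of_le_smul hpow hleU)).trans hnum⟩
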